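/- Let $\Omega\subset\mathbb R^N$ be a bounded convex domain. Let $f$ be a real function that is continuous on $\overline\Omega$, once differentiable in $\Omega$, and satisfies $f>0$ in $\Omega$; put $d\mu=f\,dx$ on $\Omega$ and $$L\psi=-\Delta\psi-\nabla(\log f)\cdot\nabla\psi .$$ For $u\in L^1(d\mu)$ with $\int_\Omega u\,d\mu=0$ define $$\|u\|_{\dot H^{-1}(d\mu)}:=\sup\Big\{\int_\Omega u\varphi\,d\mu:\ \|\varphi\|_{\dot H^1(d\mu)}=1\Big\}\in[0,\infty],\qquad \|\varphi\|_{\dot H^1(d\mu)}^2:=\int_\Omega|\nabla\varphi|^2\,d\mu ,$$ where $\varphi$ ranges over the once differentiable functions on $\Omega$ with $u\varphi\in L^1(d\mu)$, and $\sup\emptyset:=0$. Suppose that $\psi$ is continuously differentiable on $\overline\Omega$ and twice differentiable in $\Omega$, and that it solves the Neumann problem $$L\psi=u\ \text{ in }\Omega,\qquad \partial_n\psi=0\ \text{ on }\partial\Omega ,$$ where the boundary condition $\partial_n\psi=n\cdot\nabla\psi=0$ is required at every boundary point at which $\Omega$ has a unique exterior unit normal $n$. Then $|\nabla\psi|^2$,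 $\psi\,L\psi$ and $\psi u$ are $\mu$-integrable, and $$\|u\|_{\dot H^{-1}(d\mu)}^2=\int_\Omega|\nabla\psi|^2\,d\mu=\int_\Omega\psi\,(L\psi)\,d\mu=\int_\Omega\psi\,u\,d\mu .$$ -/

import Mathlib

open MeasureTheory Set
open scoped ENNReal Gradient Laplacian

noncomputable section

namespace WeightedSobolev

variable {N : ℕ}

/-- The measure `dμ = f dx` on `Ω`, where `dx` is Lebesgue measure on `ℝ^N`. -/
def densityMeasure (Ω : Set (EuclideanSpace ℝ (Fin N))) (f : EuclideanSpace ℝ (Fin N) → ℝ) :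
    Measure (EuclideanSpace ℝ (Fin N)) :=
  (volume.restrict Ω).withDensity (fun x => ENNReal.ofReal (f x))

/-- The operator `L ψ = -Δψ - ∇(log f) · ∇ψ`. -/
def opL (f ψ : EuclideanSpace ℝ (Fin N) → ℝ) (x : EuclideanSpace ℝ (Fin N)) : ℝ :=
  -(Δ ψ x) - inner ℝ (∇ (fun y => Real.log (f y)) x) (∇ ψ x)

/-- `n` is an exterior unit normal of the convex set `Ω` at the point `x`. -/
def IsExteriorUnitNormal (Ω : Set (EuclideanSpace ℝ (Fin N))) (x n : EuclideanSpace ℝ (Fin N)) :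
    Prop :=
  ‖n‖ = 1 ∧ ∀ y ∈ Ω, inner ℝ (y - x) n ≤ 0

/-- `∂ₙψ = 0` on `∂Ω`: the derivative of `ψ`, taken from within the closure of `Ω`, vanishes in
the direction of the exterior unit normal, at every boundary point at which the exterior unit
normal is determined uniquely (for a convex domain these are almost all boundary points; corners
and edges are exempt). -/
def NeumannCondition (Ω : Set (EuclideanSpace ℝ (Fin N))) (ψ : EuclideanSpace ℝ (Fin N) → ℝ) :
    Prop :=
  ∀ x ∈ frontier Ω, ∀ n, IsExteriorUnitNormal Ω x n →
    (∀ m, IsExteriorUnitNormal Ω x m → m = n) → fderivWithin ℝ ψ (closure Ω) x n = 0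

/-- `ψ` is a classical solution of `L ψ = u` in `Ω`, `∂ₙψ = 0` on `∂Ω`: it is continuously
differentiable on the closure of `Ω`, twice differentiable in `Ω`, and satisfies the equation and
the boundary condition pointwise. -/
structure IsNeumannSolution (Ω : Set (EuclideanSpace ℝ (Fin N)))
    (f u ψ : EuclideanSpace ℝ (Fin N) → ℝ) : Prop where
  contDiffOn_closure : ContDiffOn ℝ 1 ψ (closure Ω)
  differentiableOn_fderiv : DifferentiableOn ℝ (fderiv ℝ ψ) Ω
  equation : ∀ x ∈ Ω, opL f ψ x = u x
  boundary : NeumannCondition Ω ψ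

/-- `‖φ‖_{Ḣ¹(dμ)} = (∫ |∇φ|² dμ)^{1/2}`, with values in `[0, ∞]`. -/
def hDotOneNorm (μ : Measure (EuclideanSpace ℝ (Fin N))) (φ : EuclideanSpace ℝ (Fin N) → ℝ) :
    ℝ≥0∞ :=
  (∫⁻ x, ‖∇ φ x‖ₑ ^ 2 ∂μ) ^ (1 / 2 : ℝ)

/-- `‖u‖_{Ḣ⁻¹(dμ)} = sup { ∫ u φ dμ : ‖φ‖_{Ḣ¹(dμ)} = 1 }`, with values in `[0, ∞]`. The supremum is
over all once differentiable `φ` on `Ω` for which the integral exists. This set of `φ` is invariant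
under `φ ↦ -φ`, so cutting off negative values of the integral does not affect the supremum. -/
def hDotNegOneNorm (Ω : Set (EuclideanSpace ℝ (Fin N)))
    (μ : Measure (EuclideanSpace ℝ (Fin N))) (u : EuclideanSpace ℝ (Fin N) → ℝ) : ℝ≥0∞ :=
  sSup {r | ∃ φ : EuclideanSpace ℝ (Fin N) → ℝ, DifferentiableOn ℝ φ Ω ∧
    Integrable (fun x => u x * φ x) μ ∧ hDotOneNorm μ φ = 1 ∧
    r = ENNReal.ofReal (∫ x, u x * φ x ∂μ)}

end WeightedSobolev

end

/-! Everything rests on Green's identity ∫ uφ dμ = ∫ ∇φ·∇ψ dμ for every admissible φ of finite Ḣ¹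
norm (`IsNeumannSolution.integral_mul_eq`). With φ = ψ it gives the energy identity; Cauchy-Schwarz
bounds the supremum by the L² norm of ∇ψ, and ψ divided by this norm attains it.

The boundary is merely that of a convex set, and neither ∇f nor the second derivatives of ψ need be
integrable. The divergence theorem is therefore applied to the compactly supported field ηφf∇ψ with
a cutoff η, in a form that asks only for differentiability of the field and integrability of its
divergence. By the equation this divergence is η(f∇φ·∇ψ - fuφ) + φf∇η·∇ψ, so for bounded φ it
remains to find cutoffs exhausting Ω with ∫|∇η·∇ψ| → 0 (`exists_cutoff`).

Let η be a function of the gauge p of Ω about an interior point, falling from 1 to 0 in a layer of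
width of order ε. The slope is O(1/ε) and the volume of the layer O(ε), so it suffices that ∇p·∇ψ is
small near the boundary. Where p is differentiable, ∇p is a multiple of the unique exterior normal
at the radial projection to the boundary (`fderiv_gaugeAt_eq_zero`). There the Neumann condition
applies, and uniform continuity of ∇ψ carries the smallness inwards. The directions of corners and
edges are those where p is not differentiable, a null set by Rademacher. As p is only Lipschitz, it
is averaged over small balls, which preserves the estimate. -/

open Filter Topology Metric
open scoped NNReal RealInnerProductSpace

noncomputable section

/-! ### The gauge of a convex set and its exterior normals. -/

section Gauge

variable {E : Type*} [NormedAddCommGroup E] [NormedSpace ℝ E] {K : Set E} {v : E}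

/-- Euler's identity for the gauge of a set. -/
theorem fderiv_gauge_self (hd : DifferentiableAt ℝ (gauge K) v) :
    fderiv ℝ (gauge K) v v = gauge K v := by
  have h1 : HasDerivAt (fun t : ℝ => gauge K (v + t • v)) (fderiv ℝ (gauge K) v v) 0 :=
    hd.hasFDerivAt.hasLineDerivAt v
  have h2 : HasDerivAt (fun t : ℝ => (1 + t) * gauge K v) (gauge K v) 0 := by
    simpa using ((hasDerivAt_id (0 : ℝ)).const_add 1).mul_const (gauge K v)
  refine h1.unique (h2.congr_of_eventuallyEq ?_)
  filter_upwards [lt_mem_nhds (show (-1 : ℝ) < 0 by norm_num)] with t ht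
  have : v + t • v = (1 + t) • v := by rw [add_smul, one_smul]
  rw [this, gauge_smul_of_nonneg (by linarith), smul_eq_mul]

/-- The derivative of the gauge of a convex set is dominated by the gauge. -/
theorem fderiv_gauge_le (hK : Convex ℝ K) (h0 : K ∈ 𝓝 0) (hd : DifferentiableAt ℝ (gauge K) v)
    (w : E) : fderiv ℝ (gauge K) v w ≤ gauge K w := by
  refine le_of_tendsto (hd.hasFDerivAt.hasLineDerivAt w).tendsto_slope_zero_right ?_
  filter_upwards [self_mem_nhdsWithin] with t (ht : 0 < t)
  have h := gauge_add_le hK (absorbent_nhds_zero h0) v (t • w)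
  rw [gauge_smul_of_nonneg ht.le, smul_eq_mul] at h
  rw [smul_eq_mul, inv_mul_le_iff₀ ht]
  linarith

/-- A linear functional dominated by a multiple of the gauge, with equality at a point of
differentiability, is this multiple of the derivative. -/
theorem eq_smul_fderiv_gauge (hd : DifferentiableAt ℝ (gauge K) v) {c : ℝ} {l : E →L[ℝ] ℝ}
    (hl : ∀ w, l w ≤ c * gauge K w) (hv : l v = c * gauge K v) :
    l = c • fderiv ℝ (gauge K) v := by
  -- The difference is nonnegative everywhere and vanishes at `v`.
  have hmin : IsLocalMin (fun w => c * gauge K w - l w) v :=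
    Eventually.of_forall fun w => by
      have := hl w
      simp only [hv]; linarith
  have h := hmin.hasFDerivAt_eq_zero ((hd.hasFDerivAt.const_mul c).sub l.hasFDerivAt)
  exact (sub_eq_zero.1 h).symm

end Gauge

namespace WeightedSobolev

variable {N : ℕ} {Ω : Set (EuclideanSpace ℝ (Fin N))} {x₀ x : EuclideanSpace ℝ (Fin N)}

/-- The gauge of `Ω` with respect to the centre `x₀`. -/
def gaugeAt (Ω : Set (EuclideanSpace ℝ (Fin N))) (x₀ x : EuclideanSpace ℝ (Fin N)) : ℝ :=
  gauge ((fun y => y + x₀) ⁻¹' Ω) (x - x₀)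

theorem preimage_add_mem_nhds (ho : IsOpen Ω) (hx₀ : x₀ ∈ Ω) :
    (fun y => y + x₀) ⁻¹' Ω ∈ 𝓝 0 :=
  (ho.preimage (continuous_add_const x₀)).mem_nhds (by simpa using hx₀)

theorem gaugeAt_lt_one_iff (ho : IsOpen Ω) (hc : Convex ℝ Ω) (hx₀ : x₀ ∈ Ω) :
    gaugeAt Ω x₀ x < 1 ↔ x ∈ Ω := by
  rw [gaugeAt, gauge_lt_one_iff_mem_interior (hc.translate_preimage_left x₀)
    (preimage_add_mem_nhds ho hx₀),
    (ho.preimage (continuous_add_const x₀)).interior_eq]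
  simp

theorem exists_lipschitzWith_gaugeAt (ho : IsOpen Ω) (hc : Convex ℝ Ω) (hx₀ : x₀ ∈ Ω) :
    ∃ C : ℝ≥0, LipschitzWith C (gaugeAt Ω x₀) := by
  obtain ⟨C, hC⟩ := (hc.translate_preimage_left x₀).lipschitz_gauge
    (preimage_add_mem_nhds ho hx₀)
  exact ⟨C, LipschitzWith.of_dist_le_mul fun a b => by
    simpa [gaugeAt, dist_eq_norm] using hC.dist_le_mul (a - x₀) (b - x₀)⟩

theorem gaugeAt_smul {t : ℝ} (ht : 0 ≤ t) :
    gaugeAt Ω x₀ (x₀ + t • (x - x₀)) = t * gaugeAt Ω x₀ x := by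
  simp [gaugeAt, gauge_smul_of_nonneg ht]

theorem mem_frontier_of_gaugeAt_eq_one (ho : IsOpen Ω) (hc : Convex ℝ Ω) (hx₀ : x₀ ∈ Ω)
    (hx : gaugeAt Ω x₀ x = 1) : x ∈ frontier Ω := by
  have h := mem_frontier_of_gauge_eq_one (hc.translate_preimage_left x₀)
    (by simpa using hx₀) (absorbent_nhds_zero (preimage_add_mem_nhds ho hx₀)) hx
  have h2 := (Homeomorph.addRight x₀).preimage_frontier Ω
  have h3 : x - x₀ ∈ (Homeomorph.addRight x₀) ⁻¹' frontier Ω := by rw [h2]; exact h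
  simpa using h3

/-- At a point of differentiability of the gauge, its derivative vanishes on the vectors which are
orthogonal to the unique exterior unit normals, at the radial projection to the boundary. -/
theorem fderiv_gaugeAt_eq_zero (ho : IsOpen Ω) (hc : Convex ℝ Ω) (hx₀ : x₀ ∈ Ω)
    (hd : DifferentiableAt ℝ (gaugeAt Ω x₀) x) (hx : 0 < gaugeAt Ω x₀ x)
    {w : EuclideanSpace ℝ (Fin N)}
    (hw : ∀ n, IsExteriorUnitNormal Ω (x₀ + (gaugeAt Ω x₀ x)⁻¹ • (x - x₀)) n →
      (∀ m, IsExteriorUnitNormal Ω (x₀ + (gaugeAt Ω x₀ x)⁻¹ • (x - x₀)) m → m = n) →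
        inner ℝ w n = 0) :
    fderiv ℝ (gaugeAt Ω x₀) x w = 0 := by
  set K : Set (EuclideanSpace ℝ (Fin N)) := (fun y => y + x₀) ⁻¹' Ω with hK
  have hKc : Convex ℝ K := hc.translate_preimage_left x₀
  have hKo : IsOpen K := ho.preimage (continuous_add_const x₀)
  have hK0 : K ∈ 𝓝 0 := preimage_add_mem_nhds ho hx₀
  have hpd : DifferentiableAt ℝ (gauge K) (x - x₀) := by
    have h1 : DifferentiableAt ℝ (gaugeAt Ω x₀) ((x - x₀) + x₀) := by simpa using hd
    have h2 := h1.comp (x - x₀) (differentiableAt_id.add_const x₀)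
    refine h2.congr_of_eventuallyEq (Eventually.of_forall fun z => ?_)
    simp [gaugeAt, hK]
  have hfd : fderiv ℝ (gaugeAt Ω x₀) x = fderiv ℝ (gauge K) (x - x₀) :=
    fderiv_comp_sub (f := gauge K) x₀
  rw [hfd]
  have hg : gaugeAt Ω x₀ x = gauge K (x - x₀) := rfl
  rw [hg] at hw hx
  set v := x - x₀
  set g := gauge K v
  set a := ∇ (gauge K) v with ha
  have hin : ∀ z, fderiv ℝ (gauge K) v z = inner ℝ a z := fun z => by
    rw [ha, ← toDual_gradient, InnerProductSpace.toDual_apply_apply]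
  have hav : inner ℝ a v = g := by rw [← hin]; exact fderiv_gauge_self hpd
  have hale : ∀ z, inner ℝ a z ≤ gauge K z := fun z => by
    rw [← hin]; exact fderiv_gauge_le hKc hK0 hpd z
  have ha0 : 0 < ‖a‖ := by
    rw [norm_pos_iff]; rintro h
    rw [h, inner_zero_left] at hav
    exact hx.ne hav
  have hmem : ∀ z, z ∈ Ω ↔ gauge K (z - x₀) < 1 := fun z =>
    (gaugeAt_lt_one_iff ho hc hx₀).symm
  -- The functional `⟪a, ·⟫` is at most the gauge, hence below 1 on `K`, and equals 1 at `g⁻¹ • v`: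
  -- it supports `K` there.
  have hnormal : IsExteriorUnitNormal Ω (x₀ + g⁻¹ • v) (‖a‖⁻¹ • a) := by
    refine ⟨by rw [norm_smul, norm_inv, norm_norm, inv_mul_cancel₀ ha0.ne'], fun y hy => ?_⟩
    rw [inner_smul_right, real_inner_comm]
    refine mul_nonpos_of_nonneg_of_nonpos (by positivity) ?_
    have e : y - (x₀ + g⁻¹ • v) = (y - x₀) - g⁻¹ • v := by abel
    rw [e, inner_sub_right, inner_smul_right, hav, inv_mul_cancel₀ hx.ne']
    linarith [hale (y - x₀), (hmem y).1 hy]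
  -- By homogeneity, any normal `m` is dominated by `c` times the gauge, with equality at `v`. Hence
  -- `m = c • a`, and the length 1 fixes `c`.
  have huniq : ∀ m, IsExteriorUnitNormal Ω (x₀ + g⁻¹ • v) m → m = ‖a‖⁻¹ • a := by
    rintro m ⟨hm1, hm⟩
    set c : ℝ := inner ℝ m (g⁻¹ • v)
    have hm' : ∀ z ∈ K, inner ℝ m z ≤ c := fun z hz => by
      have h1 := hm (z + x₀) hz
      have e : z + x₀ - (x₀ + g⁻¹ • v) = z - g⁻¹ • v := by abel
      rw [e, real_inner_comm, inner_sub_right] at h1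
      linarith
    have hle : ∀ z, inner ℝ m z ≤ c * gauge K z := by
      intro z
      refine le_of_forall_gt_imp_ge_of_dense fun b hb => ?_
      obtain ⟨r, hr1, hr2⟩ : ∃ r, gauge K z < r ∧ c * r < b := by
        have hcont : Tendsto (fun r : ℝ => c * r) (𝓝[>] (gauge K z)) (𝓝 (c * gauge K z)) :=
          ((continuous_const_mul c).tendsto _).mono_left nhdsWithin_le_nhds
        obtain ⟨r, h1, h2⟩ := ((hcont.eventually (gt_mem_nhds hb)).and self_mem_nhdsWithin).exists
        exact ⟨r, h2, h1⟩
      have hr0 : 0 < r := (gauge_nonneg z).trans_lt hr1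
      have h3 : r⁻¹ • z ∈ K := by
        have h4 : gauge K (r⁻¹ • z) < 1 := by
          rw [gauge_smul_of_nonneg (by positivity), smul_eq_mul, inv_mul_lt_iff₀ hr0]
          linarith
        have := (gauge_lt_one_iff_mem_interior hKc hK0).1 h4
        rwa [hKo.interior_eq] at this
      have h5 := hm' _ h3
      rw [inner_smul_right, inv_mul_le_iff₀ hr0] at h5
      linarith [mul_comm c r]
    have heq : inner ℝ m v = c * gauge K v := by
      simp only [c, inner_smul_right]
      change _ = g⁻¹ * inner ℝ m v * g
      field_simp
    have h6 := eq_smul_fderiv_gauge (l := innerSL ℝ m) hpd hle heq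
    have hmc : m = c • a := by
      refine ext_inner_right ℝ fun z => ?_
      have := congrArg (fun l => l z) h6
      simpa [hin, inner_smul_left] using this
    have hc0 : 0 ≤ c := by simpa using hm' 0 (by simpa [hK] using hx₀)
    have : c * ‖a‖ = 1 := by
      rw [← hm1, hmc, norm_smul, Real.norm_of_nonneg hc0]
    rw [hmc, eq_inv_of_mul_eq_one_left this]
  have := hw _ hnormal huniq
  rw [inner_smul_right, mul_eq_zero] at this
  rw [hin, real_inner_comm]
  exact this.resolve_left (by positivity)

end WeightedSobolev

/-! ### Averaging of Lipschitz functions, and the transition function. -/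

/-- A Lipschitz function can be averaged over small balls, to give a nearby differentiable function
whose directional derivatives are controlled by those of the original function at nearby points. -/
theorem LipschitzWith.exists_differentiable_near {E : Type*} [NormedAddCommGroup E]
    [NormedSpace ℝ E] [FiniteDimensional ℝ E] [MeasurableSpace E] [BorelSpace E]
    (μ : Measure E) [μ.IsAddHaarMeasure] {C : ℝ≥0} {p : E → ℝ} (hp : LipschitzWith C p) {δ : ℝ}
    (hδ : 0 < δ) :
    ∃ q : E → ℝ, Differentiable ℝ q ∧ (∀ x, |q x - p x| ≤ C * δ) ∧
      ∀ x v b, (∀ z ∈ ball x δ, DifferentiableAt ℝ p z → |fderiv ℝ p z v| ≤ b) →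
        |fderiv ℝ q x v| ≤ b := by
  -- The uniform distribution on the ball is a good enough kernel: by Rademacher `p` is
  -- differentiable almost everywhere, and its Lipschitz constant dominates the difference
  -- quotients, so the derivative of the average is the average of the derivative.
  set ν : Measure E := ProbabilityTheory.cond μ (ball 0 δ) with hν
  have : IsProbabilityMeasure ν :=
    ProbabilityTheory.cond_isProbabilityMeasure_of_finite (measure_ball_pos μ 0 hδ).ne'
      measure_ball_lt_top.ne
  have hball : ∀ᵐ y ∂ν, y ∈ ball (0 : E) δ := ProbabilityTheory.ae_cond_mem measurableSet_ball
  have hdiff : ∀ x, ∀ᵐ y ∂ν, DifferentiableAt ℝ p (x + y) := fun x =>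
    ProbabilityTheory.cond_absolutelyContinuous.ae_le
      ((measurePreserving_add_left μ x).quasiMeasurePreserving.ae
        (hp.ae_differentiableAt (μ := μ)))
  have hcont : ∀ x, Continuous fun y => p (x + y) := fun x =>
    hp.continuous.comp (continuous_const_add x)
  have hnear : ∀ x, ∀ᵐ y ∂ν, ‖p (x + y) - p x‖ ≤ C * δ := fun x => by
    filter_upwards [hball] with y hy
    refine (hp.norm_sub_le _ _).trans ?_
    rw [add_sub_cancel_left]
    gcongr
    exact (mem_ball_zero_iff.1 hy).le
  have hint : ∀ x, Integrable (fun y => p (x + y)) ν := fun x => by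
    have h : Integrable (fun y => p (x + y) - p x) ν :=
      Integrable.of_bound ((hcont x).sub continuous_const).aestronglyMeasurable _ (hnear x)
    exact (h.add (integrable_const (p x))).congr (Eventually.of_forall fun y => by simp)
  have hder : ∀ x, Integrable (fun y => fderiv ℝ p (x + y)) ν ∧
      HasFDerivAt (fun x => ∫ y, p (x + y) ∂ν) (∫ y, fderiv ℝ p (x + y) ∂ν) x := fun x => by
    refine hasFDerivAt_integral_of_dominated_loc_of_lip (bound := fun _ => (C : ℝ))
      (F := fun x y => p (x + y)) univ_mem
      (Eventually.of_forall fun z => (hcont z).aestronglyMeasurable) (hint x) ?_ ?_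
      (integrable_const _) ?_
    · exact ((measurable_fderiv ℝ p).comp (measurable_const_add x)).aestronglyMeasurable
    · refine Eventually.of_forall fun y => ?_
      have h : LipschitzWith C fun x => p (x + y) := LipschitzWith.of_dist_le_mul fun a b => by
        simpa using hp.dist_le_mul (a + y) (b + y)
      simpa using h.lipschitzOnWith (s := univ)
    · filter_upwards [hdiff x] with y hy
      exact (hasFDerivAt_comp_add_right y).2 hy.hasFDerivAt
  refine ⟨fun x => ∫ y, p (x + y) ∂ν, fun x => (hder x).2.differentiableAt, fun x => ?_,
    fun x v b hb => ?_⟩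
  · have h : (∫ y, p (x + y) ∂ν) - p x = ∫ y, (p (x + y) - p x) ∂ν := by
      rw [integral_sub (hint x) (integrable_const _)]; simp
    rw [h]
    simpa using norm_integral_le_of_norm_le_const (hnear x)
  · rw [(hder x).2.fderiv, ContinuousLinearMap.integral_apply (hder x).1]
    have h : ∀ᵐ y ∂ν, ‖fderiv ℝ p (x + y) v‖ ≤ b := by
      filter_upwards [hball, hdiff x] with y hy hd
      exact hb _ (by simpa using hy) hd
    simpa using norm_integral_le_of_norm_le_const h

theorem Real.deriv_smoothTransition_eq_zero {t : ℝ} (h : t < 0 ∨ 1 < t) :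
    deriv Real.smoothTransition t = 0 := by
  rcases h with h | h
  · have : Real.smoothTransition =ᶠ[𝓝 t] fun _ => 0 := by
      filter_upwards [gt_mem_nhds h] with s hs
      exact Real.smoothTransition.zero_of_nonpos hs.le
    rw [this.deriv_eq, deriv_const]
  · have : Real.smoothTransition =ᶠ[𝓝 t] fun _ => 1 := by
      filter_upwards [lt_mem_nhds h] with s hs
      exact Real.smoothTransition.one_of_one_le hs.le
    rw [this.deriv_eq, deriv_const]

theorem Real.exists_norm_deriv_smoothTransition_le :
    ∃ S : ℝ, 0 ≤ S ∧ ∀ t, |deriv Real.smoothTransition t| ≤ S := by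
  have hc : Continuous (deriv Real.smoothTransition) :=
    (Real.smoothTransition.contDiff (n := 1)).continuous_deriv le_rfl
  have hs : HasCompactSupport (deriv Real.smoothTransition) := by
    refine HasCompactSupport.of_support_subset_isCompact (isCompact_Icc (a := (0 : ℝ)) (b := 1)) ?_
    intro t ht
    by_contra h
    refine ht (Real.deriv_smoothTransition_eq_zero ?_)
    rw [mem_Icc, not_and_or, not_le, not_le] at h
    exact h
  obtain ⟨S, hS⟩ := hs.exists_bound_of_continuous hc
  exact ⟨S, (norm_nonneg _).trans (hS 0), hS⟩

/-! ### Boundary layers and cutoff functions. -/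

namespace WeightedSobolev

variable {N : ℕ} {Ω : Set (EuclideanSpace ℝ (Fin N))} {x₀ x : EuclideanSpace ℝ (Fin N)}

theorem setOf_gaugeAt_lt (ho : IsOpen Ω) (hc : Convex ℝ Ω) (hx₀ : x₀ ∈ Ω) {r : ℝ} (hr : 0 < r) :
    {x | gaugeAt Ω x₀ x < r} = AffineMap.homothety x₀ r '' Ω := by
  ext x
  simp only [mem_ofPred_eq, mem_image, AffineMap.homothety_apply, vsub_eq_sub, vadd_eq_add]
  constructor
  · intro h
    refine ⟨x₀ + r⁻¹ • (x - x₀), ?_, ?_⟩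
    · rw [← gaugeAt_lt_one_iff ho hc hx₀, gaugeAt_smul (by positivity), inv_mul_lt_iff₀ hr]
      linarith
    · simp [smul_smul, hr.ne']
  · rintro ⟨y, hy, rfl⟩
    rw [add_comm, gaugeAt_smul hr.le]
    have := (gaugeAt_lt_one_iff ho hc hx₀).2 hy
    nlinarith

/-- The sublevel set of the gauge is `Ω` scaled by `r`, so the layer has volume `(1 - r ^ N)` times
that of `Ω`, and Bernoulli's inequality applies. Linearity in `1 - r` is what compensates the slope
of the cutoffs. -/
theorem measureReal_gaugeAt_layer_le (ho : IsOpen Ω) (hc : Convex ℝ Ω)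
    (hb : Bornology.IsBounded Ω) (hx₀ : x₀ ∈ Ω) {r : ℝ} (hr : 0 < r) (hr1 : r ≤ 1) :
    volume.real {x ∈ Ω | r ≤ gaugeAt Ω x₀ x} ≤ N * (1 - r) * volume.real Ω := by
  have hfin : volume Ω ≠ ∞ := hb.measure_lt_top.ne
  have h1 : {x ∈ Ω | r ≤ gaugeAt Ω x₀ x} = Ω \ {x | gaugeAt Ω x₀ x < r} := by
    ext x; simp
  have hsub : {x | gaugeAt Ω x₀ x < r} ⊆ Ω := fun x hx =>
    (gaugeAt_lt_one_iff ho hc hx₀).1 (lt_of_lt_of_le hx hr1)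
  obtain ⟨C, hC⟩ := exists_lipschitzWith_gaugeAt ho hc hx₀
  have hmeas : MeasurableSet {x | gaugeAt Ω x₀ x < r} :=
    (isOpen_lt hC.continuous continuous_const).measurableSet
  have h2 : volume.real {x | gaugeAt Ω x₀ x < r} = r ^ N * volume.real Ω := by
    rw [setOf_gaugeAt_lt ho hc hx₀ hr, measureReal_def, Measure.addHaar_image_homothety,
      ENNReal.toReal_mul, finrank_euclideanSpace_fin, ENNReal.toReal_ofReal (abs_nonneg _),
      abs_of_nonneg (by positivity), measureReal_def]
  rw [h1, measureReal_sdiff hsub hmeas hfin, h2]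
  have := one_add_mul_sub_le_pow (show -1 ≤ r by linarith) N
  nlinarith [measureReal_nonneg (μ := volume) (s := Ω)]

/-- Cutoff functions adapted to a vector field which is tangential to the boundary. -/
theorem exists_cutoff (ho : IsOpen Ω) (hc : Convex ℝ Ω) (hb : Bornology.IsBounded Ω)
    (hx₀ : x₀ ∈ Ω) {W : EuclideanSpace ℝ (Fin N) → EuclideanSpace ℝ (Fin N)}
    (hW : ContinuousOn W (closure Ω))
    (hWn : ∀ x ∈ frontier Ω, ∀ n, IsExteriorUnitNormal Ω x n →
      (∀ m, IsExteriorUnitNormal Ω x m → m = n) → inner ℝ (W x) n = 0)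
    {κ θ : ℝ} (hκ : 0 < κ) (hθ : θ < 1) :
    ∃ η : EuclideanSpace ℝ (Fin N) → ℝ, Differentiable ℝ η ∧ HasCompactSupport η ∧
      tsupport η ⊆ Ω ∧ (∀ x, |η x| ≤ 1) ∧ (∀ x, gaugeAt Ω x₀ x ≤ θ → η x = 1) ∧
      ∫⁻ x in Ω, ‖fderiv ℝ η x (W x)‖ₑ ≤ ENNReal.ofReal κ := by
  set p := gaugeAt Ω x₀ with hp
  obtain ⟨C, hC⟩ := exists_lipschitzWith_gaugeAt ho hc hx₀
  obtain ⟨S, hS0, hS⟩ := Real.exists_norm_deriv_smoothTransition_le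
  obtain ⟨R, hR0, hR⟩ := hb.closure.subset_closedBall_lt 0 x₀
  set V := volume.real Ω
  have hV : 0 ≤ V := measureReal_nonneg
  have hC0 : (0 : ℝ) ≤ C := C.2
  -- `τ` is the permitted oscillation of `W`. The left side is the final estimate: layer volume `4 *
  -- ε * N * V`, times slope `S / ε`, times `C * τ` for the derivative of `q` along `W`.
  obtain ⟨τ, hτ0, hτ⟩ : ∃ τ : ℝ, 0 < τ ∧ 4 * N * V * S * C * τ ≤ κ := by
    refine ⟨κ / (4 * N * V * S * C + 1), by positivity, ?_⟩
    rw [mul_div_assoc', div_le_iff₀ (by positivity)]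
    nlinarith
  obtain ⟨ρ, hρ0, hρ⟩ := Metric.uniformContinuousOn_iff.1
    (hb.isCompact_closure.uniformContinuousOn_of_continuous hW) τ hτ0
  -- The last condition bounds the distance from a point of the layer to the boundary point used
  -- below: less than `ε` within an averaging ball, then at most `5 * ε * R` along a ray.
  obtain ⟨ε, hε0, hε1, hεθ, hερ⟩ :
      ∃ ε : ℝ, 0 < ε ∧ ε < 1 / 10 ∧ 4 * ε ≤ 1 - θ ∧ ε + 5 * ε * R < ρ := by
    refine ⟨min (1 / 11) (min ((1 - θ) / 4) (ρ / (2 * (1 + 5 * R)))), ?_, ?_, ?_, ?_⟩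
    · have : 0 < 1 - θ := by linarith
      positivity
    · exact (min_le_left _ _).trans_lt (by norm_num)
    · have := (min_le_right (1 / 11) _).trans
        (min_le_left ((1 - θ) / 4) (ρ / (2 * (1 + 5 * R))))
      linarith
    · have := (min_le_right (1 / 11) _).trans
        (min_le_right ((1 - θ) / 4) (ρ / (2 * (1 + 5 * R))))
      rw [le_div_iff₀ (by positivity)] at this
      nlinarith
  obtain ⟨δ, hδ0, hδε, hCδ⟩ : ∃ δ : ℝ, 0 < δ ∧ δ ≤ ε ∧ C * δ ≤ ε := by
    refine ⟨ε / (C + 1), by positivity, div_le_self hε0.le (by linarith), ?_⟩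
    rw [mul_div_assoc', div_le_iff₀ (by positivity)]
    nlinarith
  obtain ⟨q, hqd, hqp, hq⟩ := hC.exists_differentiable_near volume hδ0
  have hqp' : ∀ x, |q x - p x| ≤ ε := fun x => (hqp x).trans hCδ
  -- `η` is 1 for `q ≤ 1 - 3 * ε` and 0 for `q ≥ 1 - 2 * ε`. As `q` and `p` differ by at most `ε`,
  -- it is 1 for `p ≤ 1 - 4 * ε` and supported in `p ≤ 1 - ε`.
  set η : EuclideanSpace ℝ (Fin N) → ℝ :=
    fun x => Real.smoothTransition ((1 - 2 * ε - q x) / ε) with hη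
  have hηd : ∀ x, HasFDerivAt η (deriv Real.smoothTransition ((1 - 2 * ε - q x) / ε) •
      (-ε⁻¹ • fderiv ℝ q x)) x := fun x => by
    have h1 : HasFDerivAt (fun x => (1 - 2 * ε - q x) / ε) (-ε⁻¹ • fderiv ℝ q x) x := by
      have h := ((hqd x).hasFDerivAt.const_sub (1 - 2 * ε)).mul_const ε⁻¹
      simpa [div_eq_mul_inv] using h
    have h2 := ((Real.smoothTransition.contDiff (n := 1)).differentiable one_ne_zero
      ((1 - 2 * ε - q x) / ε)).hasDerivAt
    exact h2.comp_hasFDerivAt x h1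
  have hsupp : Function.support η ⊆ {x | p x ≤ 1 - ε} := fun x hx => by
    have h : ¬ (1 - 2 * ε - q x) / ε ≤ 0 := fun h =>
      hx (Real.smoothTransition.zero_of_nonpos h)
    rw [not_le, div_pos_iff_of_pos_right hε0] at h
    have := abs_le.1 (hqp' x)
    simp only [mem_ofPred_eq]; linarith
  have hclosed : IsClosed {x | p x ≤ 1 - ε} := isClosed_le hC.continuous continuous_const
  have hsubΩ : {x | p x ≤ 1 - ε} ⊆ Ω := fun x (hx : p x ≤ 1 - ε) =>
    (gaugeAt_lt_one_iff ho hc hx₀).1 (by rw [← hp]; linarith)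
  have htsupp : tsupport η ⊆ {x | p x ≤ 1 - ε} := closure_minimal hsupp hclosed
  refine ⟨η, fun x => (hηd x).differentiableAt,
    HasCompactSupport.of_support_subset_isCompact
      (isCompact_of_isClosed_isBounded hclosed (hb.subset hsubΩ)) hsupp,
    htsupp.trans hsubΩ, fun x => ?_, fun x hx => ?_, ?_⟩
  · rw [abs_of_nonneg (Real.smoothTransition.nonneg _)]
    exact Real.smoothTransition.le_one _
  · refine Real.smoothTransition.one_of_one_le ?_
    rw [le_div_iff₀ hε0]
    have := abs_le.1 (hqp' x)
    linarith
  set A := {x ∈ Ω | 1 - 4 * ε ≤ p x} with hA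
  set B := S / ε * (C * τ) with hB
  have hAm : MeasurableSet A :=
    ho.measurableSet.inter (isClosed_le continuous_const hC.continuous).measurableSet
  have hzero : ∀ x ∈ Ω, x ∉ A → fderiv ℝ η x (W x) = 0 := fun x hx hxA => by
    have h1 : p x < 1 - 4 * ε := by
      by_contra h; exact hxA ⟨hx, not_lt.1 h⟩
    have := abs_le.1 (hqp' x)
    rw [(hηd x).fderiv, Real.deriv_smoothTransition_eq_zero, zero_smul,
      zero_apply]
    right
    rw [lt_div_iff₀ hε0]; linarith
  have hbound : ∀ x ∈ A, ‖fderiv ℝ η x (W x)‖ ≤ B := fun x hx => by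
    rw [(hηd x).fderiv]
    -- In the remaining case `p x ≤ 1 - ε`, so `p` lies between `1 - 5 * ε` and 1 on the averaging
    -- ball.
    by_cases hs : (1 - 2 * ε - q x) / ε < 0
    · rw [Real.deriv_smoothTransition_eq_zero (Or.inl hs), zero_smul,
        zero_apply, norm_zero]
      positivity
    rw [not_lt, le_div_iff₀ hε0, zero_mul] at hs
    have hqx := abs_le.1 (hqp' x)
    have hpx := hx.2
    have key : |fderiv ℝ q x (W x)| ≤ C * τ := by
      refine hq x (W x) _ fun z hz hd => ?_
      have hzx : |p z - p x| ≤ ε := by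
        refine (hC.dist_le_mul z x).trans (le_trans ?_ hCδ)
        exact mul_le_mul_of_nonneg_left (mem_ball.1 hz).le hC0
      have hzx' := abs_le.1 hzx
      have hpz0 : 0 < p z := by linarith
      have hpz1 : p z ≤ 1 := by linarith
      -- The radial projection of `z` to the boundary: the derivative of `p` at `z` kills `W y`, so
      -- only `W x - W y` contributes.
      set y := x₀ + (p z)⁻¹ • (z - x₀) with hy
      have hyf : y ∈ frontier Ω := mem_frontier_of_gaugeAt_eq_one ho hc hx₀ (by
        rw [hy, gaugeAt_smul (by positivity)]; exact inv_mul_cancel₀ hpz0.ne')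
      have hycl : y ∈ closure Ω := frontier_subset_closure hyf
      have hyz : dist z y ≤ 5 * ε * R := by
        have e : z - y = -((1 - p z) • (y - x₀)) := by
          have e1 : z - x₀ = p z • (y - x₀) := by
            simp [hy, smul_smul, hpz0.ne']
          have e2 : z - y = (z - x₀) - (y - x₀) := by abel
          rw [e2, e1, sub_smul, one_smul]; abel
        rw [dist_eq_norm, e, norm_neg, norm_smul, Real.norm_of_nonneg (by linarith),
          ← dist_eq_norm]
        exact mul_le_mul (by linarith) (mem_closedBall.1 (hR hycl)) dist_nonneg (by linarith)
      have hxy : dist x y < ρ := by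
        have h1 := dist_triangle x z y
        have h2 := mem_ball'.1 hz
        linarith
      have hWxy : ‖W x - W y‖ ≤ τ := by
        rw [← dist_eq_norm]; exact (hρ x (subset_closure hx.1) y hycl hxy).le
      have hWy : fderiv ℝ p z (W y) = 0 :=
        fderiv_gaugeAt_eq_zero ho hc hx₀ hd hpz0 (hWn y hyf)
      have e : fderiv ℝ p z (W x) = fderiv ℝ p z (W x - W y) := by rw [map_sub, hWy, sub_zero]
      rw [e]
      refine ((fderiv ℝ p z).le_opNorm _).trans ?_
      exact mul_le_mul (norm_fderiv_le_of_lipschitz ℝ hC) hWxy (norm_nonneg _) hC0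
    rw [smul_apply, smul_apply, norm_smul, norm_smul,
      norm_neg, norm_inv, Real.norm_of_nonneg hε0.le, ← mul_assoc, hB, div_eq_mul_inv S]
    refine mul_le_mul (mul_le_mul_of_nonneg_right (hS _) (by positivity)) key (norm_nonneg _)
      (by positivity)
  have hlint : ∫⁻ x in Ω, ‖fderiv ℝ η x (W x)‖ₑ ≤ ∫⁻ x in A, ENNReal.ofReal B := by
    rw [← lintegral_indicator ho.measurableSet, ← lintegral_indicator hAm]
    refine lintegral_mono fun x => ?_
    by_cases hxA : x ∈ A
    · rw [indicator_of_mem hxA, indicator_of_mem hxA.1, ← ofReal_norm]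
      exact ENNReal.ofReal_le_ofReal (hbound x hxA)
    · by_cases hxΩ : x ∈ Ω
      · rw [indicator_of_mem hxΩ, hzero x hxΩ hxA]; simp
      · rw [indicator_of_notMem hxΩ]; exact zero_le
  refine hlint.trans ?_
  have hAfin : volume A ≠ ∞ := (hb.subset (sep_subset _ _)).measure_lt_top.ne
  rw [setLIntegral_const, ← ENNReal.ofReal_toReal hAfin, ← ENNReal.ofReal_mul (by positivity)]
  refine ENNReal.ofReal_le_ofReal (le_trans ?_ hτ)
  have hvol := measureReal_gaugeAt_layer_le ho hc hb hx₀ (r := 1 - 4 * ε) (by linarith)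
    (by linarith)
  calc B * (volume A).toReal ≤ B * (N * (1 - (1 - 4 * ε)) * V) := by
        refine mul_le_mul_of_nonneg_left hvol (by positivity)
    _ = 4 * N * V * S * C * τ := by rw [hB]; field_simp; ring

/-- A sequence of cutoff functions exhausting `Ω`, for a vector field which is tangential to the
boundary. -/
theorem exists_cutoff_seq (ho : IsOpen Ω) (hc : Convex ℝ Ω) (hb : Bornology.IsBounded Ω)
    (hx₀ : x₀ ∈ Ω) {W : EuclideanSpace ℝ (Fin N) → EuclideanSpace ℝ (Fin N)}
    (hW : ContinuousOn W (closure Ω))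
    (hWn : ∀ x ∈ frontier Ω, ∀ n, IsExteriorUnitNormal Ω x n →
      (∀ m, IsExteriorUnitNormal Ω x m → m = n) → inner ℝ (W x) n = 0) :
    ∃ η : ℕ → EuclideanSpace ℝ (Fin N) → ℝ, (∀ n, Differentiable ℝ (η n)) ∧
      (∀ n, HasCompactSupport (η n)) ∧ (∀ n, tsupport (η n) ⊆ Ω) ∧ (∀ n x, |η n x| ≤ 1) ∧
      (∀ x ∈ Ω, ∀ᶠ n in atTop, η n x = 1) ∧
      (∀ n, ∫⁻ x in Ω, ‖fderiv ℝ (η n) x (W x)‖ₑ ≠ ∞) ∧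
      Tendsto (fun n => ∫⁻ x in Ω, ‖fderiv ℝ (η n) x (W x)‖ₑ) atTop (𝓝 0) := by
  choose η h1 h2 h3 h4 h5 h6 using fun n : ℕ =>
    exists_cutoff ho hc hb hx₀ hW hWn (κ := 1 / ((n : ℝ) + 1)) (θ := 1 - 1 / ((n : ℝ) + 1))
      (by positivity) (sub_lt_self _ (by positivity))
  refine ⟨η, h1, h2, h3, h4, fun x hx => ?_,
    fun n => ((h6 n).trans_lt ENNReal.ofReal_lt_top).ne, ?_⟩
  · have hlt := (gaugeAt_lt_one_iff ho hc hx₀).2 hx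
    filter_upwards [tendsto_one_div_add_atTop_nhds_zero_nat.eventually
      (gt_mem_nhds (sub_pos.2 hlt))] with n hn
    exact h5 n x (by linarith)
  · refine tendsto_of_tendsto_of_tendsto_of_le_of_le tendsto_const_nhds ?_
      (fun n => zero_le) h6
    simpa using ENNReal.tendsto_ofReal tendsto_one_div_add_atTop_nhds_zero_nat

end WeightedSobolev

/-! ### The divergence theorem for compactly supported differentiable fields. -/

/-- The divergence of a vector field on Euclidean space. -/
def vectorDiv {N : ℕ} (G : EuclideanSpace ℝ (Fin N) → EuclideanSpace ℝ (Fin N))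
    (x : EuclideanSpace ℝ (Fin N)) : ℝ :=
  ∑ i, (fderiv ℝ G x (EuclideanSpace.single i 1)) i

/-- The divergence theorem for differentiable vector fields of compact support, whose divergence
is only supposed to be integrable. -/
theorem integral_vectorDiv_eq_zero {N : ℕ}
    {G : EuclideanSpace ℝ (Fin N) → EuclideanSpace ℝ (Fin N)} (hd : Differentiable ℝ G)
    (hs : HasCompactSupport G) (hi : Integrable (vectorDiv G)) : ∫ x, vectorDiv G x = 0 := by
  rcases N with _ | n
  · simp [vectorDiv]
  obtain ⟨R, hR0, hR⟩ := hs.isCompact.isBounded.subset_closedBall_lt 0 0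
  have hG0 : ∀ x : EuclideanSpace ℝ (Fin (n + 1)), ∀ i, R < |x i| → x ∉ tsupport G := by
    intro x i hx hxs
    have h1 := mem_closedBall_zero_iff.1 (hR hxs)
    have h3 : ‖x i‖ ≤ ‖x‖ := PiLp.norm_apply_le x i
    rw [Real.norm_eq_abs] at h3
    linarith
  set L := (EuclideanSpace.equiv (Fin (n + 1)) ℝ) with hL
  set F : (Fin (n + 1) → ℝ) → (Fin (n + 1) → ℝ) := fun y => L (G (L.symm y)) with hF
  set F' : (Fin (n + 1) → ℝ) → (Fin (n + 1) → ℝ) →L[ℝ] (Fin (n + 1) → ℝ) := fun y =>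
    (L : _ →L[ℝ] _).comp ((fderiv ℝ G (L.symm y)).comp (L.symm : _ →L[ℝ] _)) with hF'
  have hFd : ∀ y, HasFDerivAt F (F' y) y := fun y =>
    L.hasFDerivAt.comp y ((hd (L.symm y)).hasFDerivAt.comp y L.symm.hasFDerivAt)
  have hdiv : ∀ y, ∑ i, F' y (Pi.single i 1) i = vectorDiv G (L.symm y) := fun y => by
    rfl
  have hmp : MeasurePreserving (fun y => L.symm y) volume volume :=
    PiLp.volume_preserving_toLp (Fin (n + 1))
  have hemb : MeasurableEmbedding (fun y => L.symm y) :=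
    L.symm.toHomeomorph.measurableEmbedding
  have hint : Integrable (fun y => vectorDiv G (L.symm y)) :=
    (hmp.integrable_comp_emb hemb).2 hi
  have hF0 : ∀ y : Fin (n + 1) → ℝ, ∀ i, R < |y i| → F y = 0 := fun y i hy => by
    have := image_eq_zero_of_notMem_tsupport (hG0 (L.symm y) i hy)
    simp [hF, this]
  -- The box strictly contains the support, so every face integral vanishes.
  set a : Fin (n + 1) → ℝ := fun _ => -(R + 1)
  set b : Fin (n + 1) → ℝ := fun _ => R + 1
  have hbox := integral_divergence_of_hasFDerivAt_off_countable a b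
    (fun i => by simp only [a, b]; linarith) F F' ∅ countable_empty
    (fun y _ => (hFd y).continuousAt.continuousWithinAt) (fun y _ => hFd y)
    (by simpa only [hdiv] using hint.integrableOn)
  have hfaces : ∀ i : Fin (n + 1), ∀ t : ℝ, R < |t| → ∀ z, F (i.insertNth t z) i = 0 :=
    fun i t ht z => by rw [hF0 _ i (by simpa using ht)]; rfl
  have hb : R < |R + 1| := by rw [abs_of_pos (by linarith)]; linarith
  have ha : R < |(-(R + 1))| := by rwa [abs_neg]
  simp only [a, b, hfaces _ _ hb, hfaces _ _ ha, integral_zero, sub_zero,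
    Finset.sum_const_zero, hdiv] at hbox
  rw [← hmp.integral_comp hemb, ← hbox, setIntegral_eq_integral_of_forall_compl_eq_zero]
  intro y hy
  have : ∃ i, R < |y i| := by
    by_contra! h
    refine hy ⟨fun i => ?_, fun i => ?_⟩
    · have := abs_le.1 (h i); linarith
    · have := abs_le.1 (h i); linarith
  obtain ⟨i, hi⟩ := this
  have hn := hG0 (L.symm y) i hi
  have h0 : fderiv ℝ G (L.symm y) = 0 := by
    have : G =ᶠ[𝓝 (L.symm y)] fun _ => 0 := notMem_tsupport_iff_eventuallyEq.1 hn
    rw [this.fderiv_eq]; simp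
  simp [vectorDiv, h0]

/-- The product rule for the divergence. -/
theorem vectorDiv_smul {N : ℕ} {h : EuclideanSpace ℝ (Fin N) → ℝ}
    {V : EuclideanSpace ℝ (Fin N) → EuclideanSpace ℝ (Fin N)} {x : EuclideanSpace ℝ (Fin N)}
    (hh : DifferentiableAt ℝ h x) (hV : DifferentiableAt ℝ V x) :
    vectorDiv (fun y => h y • V y) x = h x * vectorDiv V x + fderiv ℝ h x (V x) := by
  have e : fderiv ℝ h x (V x) = ∑ i, fderiv ℝ h x (EuclideanSpace.single i 1) * V x i := by
    conv_lhs => rw [← (EuclideanSpace.basisFun (Fin N) ℝ).sum_repr (V x)]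
    simp [mul_comm]
  rw [e, vectorDiv, vectorDiv, Finset.mul_sum, ← Finset.sum_add_distrib]
  refine Finset.sum_congr rfl fun i _ => ?_
  rw [(hh.hasFDerivAt.fun_smul hV.hasFDerivAt).fderiv]
  simp

/-- The Riesz isomorphism of a finite-dimensional real space, as a continuous linear map. -/
def rieszCLM (E : Type*) [NormedAddCommGroup E] [InnerProductSpace ℝ E] [FiniteDimensional ℝ E] :
    (E →L[ℝ] ℝ) →L[ℝ] E :=
  LinearMap.toContinuousLinearMap
    { toFun := fun l => (InnerProductSpace.toDual ℝ E).symm l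
      map_add' := fun a b => map_add _ a b
      map_smul' := fun c a => by simp }

theorem hasFDerivAt_gradient {E : Type*} [NormedAddCommGroup E] [InnerProductSpace ℝ E]
    [FiniteDimensional ℝ E] {ψ : E → ℝ} {x : E} (h : DifferentiableAt ℝ (fderiv ℝ ψ) x) :
    HasFDerivAt (∇ ψ) ((rieszCLM E).comp (fderiv ℝ (fderiv ℝ ψ) x)) x :=
  (rieszCLM E).hasFDerivAt.comp x h.hasFDerivAt

/-- The Laplacian of a twice differentiable function is the divergence of its gradient. -/
theorem vectorDiv_gradient {N : ℕ} {ψ : EuclideanSpace ℝ (Fin N) → ℝ}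
    {x : EuclideanSpace ℝ (Fin N)} (h : DifferentiableAt ℝ (fderiv ℝ ψ) x) :
    vectorDiv (∇ ψ) x = Δ ψ x := by
  rw [InnerProductSpace.laplacian_eq_iteratedFDeriv_orthonormalBasis ψ
    (EuclideanSpace.basisFun (Fin N) ℝ), vectorDiv]
  refine Finset.sum_congr rfl fun i _ => ?_
  rw [iteratedFDeriv_two_apply]
  rw [(hasFDerivAt_gradient h).fderiv]
  set l := fderiv ℝ (fderiv ℝ ψ) x (EuclideanSpace.single i 1) with hl
  change ((InnerProductSpace.toDual ℝ (EuclideanSpace ℝ (Fin N))).symm l) i = _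
  have h2 : inner ℝ ((InnerProductSpace.toDual ℝ (EuclideanSpace ℝ (Fin N))).symm l)
      (EuclideanSpace.single i 1) = l (EuclideanSpace.single i 1) :=
    InnerProductSpace.toDual_symm_apply
  rw [EuclideanSpace.inner_single_right] at h2
  simpa [hl] using h2

/-- Measurability of `fderiv` needs no regularity; test functions are only differentiable, and their
gradients may be discontinuous. -/
theorem measurable_gradient {E : Type*} [NormedAddCommGroup E] [InnerProductSpace ℝ E]
    [FiniteDimensional ℝ E] [MeasurableSpace E] [BorelSpace E] (φ : E → ℝ) : Measurable (∇ φ) :=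
  (rieszCLM E).continuous.measurable.comp (measurable_fderiv ℝ φ)

/-! ### The weighted measure, and Green's identity for bounded test functions. -/

namespace WeightedSobolev

variable {N : ℕ} {Ω : Set (EuclideanSpace ℝ (Fin N))} {f u ψ φ : EuclideanSpace ℝ (Fin N) → ℝ}
  {x : EuclideanSpace ℝ (Fin N)}

section DensityMeasure

theorem densityMeasure_absolutelyContinuous :
    densityMeasure Ω f ≪ volume.restrict Ω :=
  withDensity_absolutelyContinuous _ _

theorem ae_densityMeasure_mem (ho : IsOpen Ω) : ∀ᵐ x ∂densityMeasure Ω f, x ∈ Ω :=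
  densityMeasure_absolutelyContinuous.ae_le (ae_restrict_mem ho.measurableSet)

theorem aemeasurable_density (ho : IsOpen Ω) (hf : ContinuousOn f Ω) :
    AEMeasurable (fun x => ENNReal.ofReal (f x)) (volume.restrict Ω) :=
  (hf.aemeasurable ho.measurableSet).ennreal_ofReal

theorem integrable_densityMeasure_iff (ho : IsOpen Ω) (hf : ContinuousOn f Ω)
    (hpos : ∀ x ∈ Ω, 0 < f x) {g : EuclideanSpace ℝ (Fin N) → ℝ} :
    Integrable g (densityMeasure Ω f) ↔ IntegrableOn (fun x => f x * g x) Ω := by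
  rw [densityMeasure, integrable_withDensity_iff_integrable_smul₀' (aemeasurable_density ho hf)
    (Eventually.of_forall fun _ => ENNReal.ofReal_lt_top), IntegrableOn]
  refine integrable_congr ?_
  filter_upwards [ae_restrict_mem ho.measurableSet] with x hx
  rw [ENNReal.toReal_ofReal (hpos x hx).le, smul_eq_mul]

theorem integral_densityMeasure (ho : IsOpen Ω) (hf : ContinuousOn f Ω)
    (hpos : ∀ x ∈ Ω, 0 < f x) (g : EuclideanSpace ℝ (Fin N) → ℝ) :
    ∫ x, g x ∂densityMeasure Ω f = ∫ x in Ω, f x * g x := by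
  rw [densityMeasure, integral_withDensity_eq_integral_toReal_smul₀ (aemeasurable_density ho hf)
    (Eventually.of_forall fun _ => ENNReal.ofReal_lt_top)]
  refine integral_congr_ae ?_
  filter_upwards [ae_restrict_mem ho.measurableSet] with x hx
  rw [ENNReal.toReal_ofReal (hpos x hx).le, smul_eq_mul]

theorem exists_norm_le_of_continuousOn_closure {F : Type*} [NormedAddCommGroup F]
    (hb : Bornology.IsBounded Ω) {g : EuclideanSpace ℝ (Fin N) → F}
    (hg : ContinuousOn g (closure Ω)) : ∃ B, 0 ≤ B ∧ ∀ x ∈ Ω, ‖g x‖ ≤ B := by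
  obtain ⟨B, hB⟩ := hb.isCompact_closure.exists_bound_of_continuousOn hg
  exact ⟨max B 0, le_max_right _ _, fun x hx => (hB x (subset_closure hx)).trans (le_max_left _ _)⟩

theorem isFiniteMeasure_densityMeasure (hb : Bornology.IsBounded Ω) (ho : IsOpen Ω)
    (hf : ContinuousOn f (closure Ω)) : IsFiniteMeasure (densityMeasure Ω f) := by
  obtain ⟨B, hB0, hB⟩ := exists_norm_le_of_continuousOn_closure hb hf
  refine isFiniteMeasure_withDensity (ne_of_lt ?_)
  refine (setLIntegral_mono' (g := fun _ => ENNReal.ofReal B) ho.measurableSet fun x hx =>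
    ENNReal.ofReal_le_ofReal ((le_abs_self _).trans (hB x hx))).trans_lt ?_
  rw [setLIntegral_const]
  exact ENNReal.mul_lt_top ENNReal.ofReal_lt_top hb.measure_lt_top

end DensityMeasure

section Solution

theorem uniqueDiffOn_closure (ho : IsOpen Ω) (hc : Convex ℝ Ω) (hne : Ω.Nonempty) :
    UniqueDiffOn ℝ (closure Ω) :=
  uniqueDiffOn_convex hc.closure
    (hne.mono (interior_maximal subset_closure ho))

theorem gradientWithin_closure_eq (ho : IsOpen Ω) (hx : x ∈ Ω) :
    gradientWithin ψ (closure Ω) x = ∇ ψ x := by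
  rw [gradientWithin, gradient,
    fderivWithin_of_mem_nhds (mem_of_superset (ho.mem_nhds hx) subset_closure)]

/-- This extension of `∇ ψ` to the boundary is the field to which the cutoffs are adapted; the
Neumann condition says that it is tangential. -/
theorem IsNeumannSolution.continuousOn_gradientWithin (ho : IsOpen Ω) (hc : Convex ℝ Ω)
    (hne : Ω.Nonempty) (hψ : IsNeumannSolution Ω f u ψ) :
    ContinuousOn (gradientWithin ψ (closure Ω)) (closure Ω) :=
  (rieszCLM _).continuous.comp_continuousOn
    (hψ.contDiffOn_closure.continuousOn_fderivWithin (uniqueDiffOn_closure ho hc hne) le_rfl)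

theorem IsNeumannSolution.exists_norm_gradient_le (ho : IsOpen Ω) (hc : Convex ℝ Ω)
    (hb : Bornology.IsBounded Ω) (hne : Ω.Nonempty) (hψ : IsNeumannSolution Ω f u ψ) :
    ∃ B, 0 ≤ B ∧ ∀ x ∈ Ω, ‖∇ ψ x‖ ≤ B := by
  obtain ⟨B, hB0, hB⟩ := exists_norm_le_of_continuousOn_closure hb
    (hψ.continuousOn_gradientWithin ho hc hne)
  exact ⟨B, hB0, fun x hx => by rw [← gradientWithin_closure_eq ho hx]; exact hB x hx⟩

theorem IsNeumannSolution.differentiableOn (hψ : IsNeumannSolution Ω f u ψ) :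
    DifferentiableOn ℝ ψ Ω :=
  (hψ.contDiffOn_closure.differentiableOn one_ne_zero).mono subset_closure

/-- The equation `L ψ = u` in divergence form. -/
theorem mul_laplacian_add_fderiv (hfx : DifferentiableAt ℝ f x) (hpos : 0 < f x)
    (h : opL f ψ x = u x) : f x * Δ ψ x + fderiv ℝ f x (∇ ψ x) = -(f x * u x) := by
  rw [← h, opL, inner_gradient_left, (hfx.hasFDerivAt.log hpos.ne').fderiv, smul_apply,
    smul_eq_mul]
  field_simp
  ring

/-- Green's identity for bounded test functions. -/
theorem IsNeumannSolution.integral_mul_eq_of_bounded (ho : IsOpen Ω) (hc : Convex ℝ Ω)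
    (hb : Bornology.IsBounded Ω) (hne : Ω.Nonempty) (hfd : DifferentiableOn ℝ f Ω)
    (hfc : ContinuousOn f (closure Ω)) (hpos : ∀ x ∈ Ω, 0 < f x)
    (hψ : IsNeumannSolution Ω f u ψ) (hφ : DifferentiableOn ℝ φ Ω) {M : ℝ}
    (hM : ∀ x ∈ Ω, |φ x| ≤ M) (hu : Integrable (fun x => u x * φ x) (densityMeasure Ω f))
    (hi : Integrable (fun x => inner ℝ (∇ φ x) (∇ ψ x)) (densityMeasure Ω f)) :
    ∫ x, u x * φ x ∂densityMeasure Ω f =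
      ∫ x, inner ℝ (∇ φ x) (∇ ψ x) ∂densityMeasure Ω f := by
  obtain ⟨x₀, hx₀⟩ := hne
  have hfc' : ContinuousOn f Ω := hfc.mono subset_closure
  obtain ⟨F, hF0, hF⟩ := exists_norm_le_of_continuousOn_closure hb hfc
  have hM0 : 0 ≤ M := (abs_nonneg _).trans (hM x₀ hx₀)
  obtain ⟨η, hηd, hηc, hηs, hη1, hηlim, hηfin, hη0⟩ := exists_cutoff_seq ho hc hb hx₀
    (hψ.continuousOn_gradientWithin ho hc ⟨x₀, hx₀⟩) (fun y hy n hn hn' => by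
      rw [gradientWithin, InnerProductSpace.toDual_symm_apply]
      exact hψ.boundary y hy n hn hn')
  have hηeq : ∀ n, ∫⁻ x in Ω, ‖fderiv ℝ (η n) x (gradientWithin ψ (closure Ω) x)‖ₑ =
      ∫⁻ x in Ω, ‖fderiv ℝ (η n) x (∇ ψ x)‖ₑ := fun n =>
    setLIntegral_congr_fun ho.measurableSet fun x hx => by
      simp only [gradientWithin_closure_eq ho hx]
  simp only [hηeq] at hηfin hη0
  rw [integral_densityMeasure ho hfc' hpos, integral_densityMeasure ho hfc' hpos]
  rw [integrable_densityMeasure_iff ho hfc' hpos] at hu hi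
  set D : EuclideanSpace ℝ (Fin N) → ℝ := fun x =>
    f x * inner ℝ (∇ φ x) (∇ ψ x) - f x * (u x * φ x) with hD
  have hDi : IntegrableOn D Ω := hi.sub hu
  suffices h : ∫ x in Ω, D x = 0 by
    rw [hD, integral_sub hi hu] at h
    linarith
  -- The error due to the cutoff; its integral tends to 0 because `φ * f` is bounded on `Ω`.
  set R : ℕ → EuclideanSpace ℝ (Fin N) → ℝ := fun n x =>
    φ x * f x * fderiv ℝ (η n) x (∇ ψ x) with hR
  have hRb : ∀ n, ∫⁻ x in Ω, ‖R n x‖ₑ ≤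
      ENNReal.ofReal (M * F) * ∫⁻ x in Ω, ‖fderiv ℝ (η n) x (∇ ψ x)‖ₑ := fun n => by
    rw [← lintegral_const_mul' _ _ ENNReal.ofReal_ne_top]
    refine setLIntegral_mono' ho.measurableSet fun x hx => ?_
    rw [hR, enorm_mul]
    gcongr
    rw [← ofReal_norm, norm_mul]
    exact ENNReal.ofReal_le_ofReal (mul_le_mul (hM x hx) (hF x hx) (norm_nonneg _) hM0)
  have hVm : Measurable (∇ ψ) := measurable_gradient ψ
  have hRm : ∀ n, AEStronglyMeasurable (R n) (volume.restrict Ω) := fun n => by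
    have h1 : AEStronglyMeasurable (fun x => φ x * f x) (volume.restrict Ω) :=
      (hφ.continuousOn.mul hfc').aestronglyMeasurable ho.measurableSet
    have h2 : Measurable fun x => fderiv ℝ (η n) x (∇ ψ x) := by
      simp only [← inner_gradient_left]
      exact (measurable_gradient (η n)).inner hVm
    exact h1.mul h2.aestronglyMeasurable
  have hRi : ∀ n, IntegrableOn (R n) Ω := fun n =>
    ⟨hRm n, (hRb n).trans_lt (ENNReal.mul_lt_top ENNReal.ofReal_lt_top (hηfin n).lt_top)⟩
  have hR0 : Tendsto (fun n => ∫ x in Ω, R n x) atTop (𝓝 0) := by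
    rw [tendsto_zero_iff_enorm_tendsto_zero]
    refine tendsto_of_tendsto_of_tendsto_of_le_of_le tendsto_const_nhds ?_ (fun _ => zero_le)
      (fun n => (enorm_integral_le_lintegral_enorm _).trans (hRb n))
    simpa using ENNReal.Tendsto.const_mul hη0 (Or.inr ENNReal.ofReal_ne_top)
  have hηDi : ∀ n, IntegrableOn (fun x => η n x * D x) Ω := fun n =>
    hDi.bdd_mul (c := 1) (hηd n).continuous.aestronglyMeasurable
      (Eventually.of_forall fun x => hη1 n x)
  have hDlim : Tendsto (fun n => ∫ x in Ω, η n x * D x) atTop (𝓝 (∫ x in Ω, D x)) := by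
    refine tendsto_integral_of_dominated_convergence (fun x => ‖D x‖)
      (fun n => (hηDi n).aestronglyMeasurable) hDi.norm
      (fun n => Eventually.of_forall fun x => ?_) ?_
    · rw [norm_mul]
      exact mul_le_of_le_one_left (norm_nonneg _) (hη1 n x)
    · filter_upwards [ae_restrict_mem ho.measurableSet] with x hx
      refine tendsto_const_nhds.congr' ?_
      filter_upwards [hηlim x hx] with n hn
      rw [hn, one_mul]
  -- Terms such as `Δ ψ` or `∇ f` need not be integrable separately; the equation combines them into
  -- the integrable divergence `η n * D + R n`.
  have hgreen : ∀ n, (∫ x in Ω, η n x * D x) + ∫ x in Ω, R n x = 0 := fun n => by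
    set h : EuclideanSpace ℝ (Fin N) → ℝ := fun x => η n x * (φ x * f x) with hh
    set G : EuclideanSpace ℝ (Fin N) → EuclideanSpace ℝ (Fin N) := fun x => h x • ∇ ψ x with hG
    have hout : ∀ x, x ∉ tsupport (η n) → G =ᶠ[𝓝 x] fun _ => 0 := fun x hx => by
      filter_upwards [notMem_tsupport_iff_eventuallyEq.1 hx] with y hy
      simp [hG, hh, hy]
    have hhd : ∀ x ∈ Ω, HasFDerivAt h (η n x • (φ x • fderiv ℝ f x + f x • fderiv ℝ φ x) +
        (φ x * f x) • fderiv ℝ (η n) x) x := fun x hx =>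
      ((hηd n) x).hasFDerivAt.mul (((hφ.differentiableAt (ho.mem_nhds hx)).hasFDerivAt).mul
        (hfd.differentiableAt (ho.mem_nhds hx)).hasFDerivAt)
    have hVd : ∀ x ∈ Ω, DifferentiableAt ℝ (fderiv ℝ ψ) x := fun x hx =>
      hψ.differentiableOn_fderiv.differentiableAt (ho.mem_nhds hx)
    have hGd : Differentiable ℝ G := fun x => by
      by_cases hx : x ∈ tsupport (η n)
      · exact (hhd x (hηs n hx)).differentiableAt.smul
          (hasFDerivAt_gradient (hVd x (hηs n hx))).differentiableAt
      · exact (hout x hx).differentiableAt_iff.2 (differentiableAt_const _)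
    have hGc : HasCompactSupport G := by
      refine (hηc n).mono fun x hx => ?_
      contrapose! hx
      have : η n x = 0 := by simpa using hx
      simp [hG, hh, this]
    have hdivG : vectorDiv G = indicator Ω (fun x => η n x * D x + R n x) := by
      ext x
      by_cases hx : x ∈ Ω
      · rw [indicator_of_mem hx, hG, vectorDiv_smul (hhd x hx).differentiableAt
          (hasFDerivAt_gradient (hVd x hx)).differentiableAt, vectorDiv_gradient (hVd x hx),
          (hhd x hx).fderiv]
        have heq := mul_laplacian_add_fderiv (hfd.differentiableAt (ho.mem_nhds hx)) (hpos x hx)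
          (hψ.equation x hx)
        simp only [hD, hR, hh, inner_gradient_left, add_apply, smul_apply, smul_eq_mul]
        linear_combination (η n x * φ x) * heq
      · rw [indicator_of_notMem hx, vectorDiv, (hout x fun hs => hx (hηs n hs)).fderiv_eq]
        simp
    have hint : Integrable (vectorDiv G) := by
      rw [hdivG, integrable_indicator_iff ho.measurableSet]
      exact (hηDi n).add (hRi n)
    have := integral_vectorDiv_eq_zero hGd hGc hint
    rwa [hdivG, integral_indicator ho.measurableSet, integral_add (hηDi n) (hRi n)] at this
  have hlim := hDlim.add hR0
  simp only [hgreen, add_zero] at hlim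
  exact tendsto_nhds_unique hlim tendsto_const_nhds

end Solution

end WeightedSobolev

/-! ### Unbounded test functions, and the Cauchy-Schwarz inequality. -/

namespace WeightedSobolev

variable {N : ℕ} {Ω : Set (EuclideanSpace ℝ (Fin N))} {f u ψ φ : EuclideanSpace ℝ (Fin N) → ℝ}
  {x : EuclideanSpace ℝ (Fin N)}

/-- The map `t / (1 + s * t ^ 2)` serves as a truncation: unlike clipping at a level it preserves
differentiability. For `0 < s` it is bounded, its slope is at most 1 in absolute value, and it tends
to `t` as `s` tends to 0. -/
theorem hasDerivAt_div_one_add_mul_sq {s : ℝ} (hs : 0 ≤ s) (t : ℝ) :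
    HasDerivAt (fun t => t / (1 + s * t ^ 2)) ((1 - s * t ^ 2) / (1 + s * t ^ 2) ^ 2) t := by
  have h1 : HasDerivAt (fun t : ℝ => 1 + s * t ^ 2) (s * (2 * t)) t := by
    simpa using ((hasDerivAt_pow 2 t).const_mul s).const_add 1
  have h0 : 1 + s * t ^ 2 ≠ 0 := by positivity
  have h2 := (hasDerivAt_id t).div h1 h0
  refine h2.congr_deriv ?_
  simp only [id]
  congr 1
  ring

theorem abs_div_one_add_mul_sq_le {s : ℝ} (hs : 0 < s) (hs1 : s ≤ 1) (t : ℝ) :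
    |t / (1 + s * t ^ 2)| ≤ 1 / s := by
  rw [abs_div, abs_of_pos (show 0 < 1 + s * t ^ 2 by positivity),
    div_le_div_iff₀ (by positivity) hs, ← sq_abs t]
  nlinarith [mul_nonneg hs.le (sq_nonneg (|t| - 1))]

theorem abs_one_sub_div_le {s : ℝ} (hs : 0 ≤ s) (t : ℝ) :
    |(1 - s * t ^ 2) / (1 + s * t ^ 2) ^ 2| ≤ 1 := by
  have h : 0 ≤ s * t ^ 2 := by positivity
  rw [abs_div, abs_of_pos (show 0 < (1 + s * t ^ 2) ^ 2 by positivity), div_le_one (by positivity),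
    abs_le]
  constructor <;> nlinarith

/-- Green's identity for test functions with a square integrable gradient. -/
theorem IsNeumannSolution.integral_mul_eq (ho : IsOpen Ω) (hc : Convex ℝ Ω)
    (hb : Bornology.IsBounded Ω) (hne : Ω.Nonempty) (hfd : DifferentiableOn ℝ f Ω)
    (hfc : ContinuousOn f (closure Ω)) (hpos : ∀ x ∈ Ω, 0 < f x)
    (hψ : IsNeumannSolution Ω f u ψ) (hφ : DifferentiableOn ℝ φ Ω)
    (hu : Integrable (fun x => u x * φ x) (densityMeasure Ω f))
    (hi : Integrable (fun x => inner ℝ (∇ φ x) (∇ ψ x)) (densityMeasure Ω f)) :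
    ∫ x, u x * φ x ∂densityMeasure Ω f =
      ∫ x, inner ℝ (∇ φ x) (∇ ψ x) ∂densityMeasure Ω f := by
  set μ := densityMeasure Ω f
  have hmem : ∀ᵐ x ∂μ, x ∈ Ω := ae_densityMeasure_mem ho
  have hφm : AEMeasurable φ μ :=
    (hφ.continuousOn.aemeasurable ho.measurableSet).mono_ac densityMeasure_absolutelyContinuous
  set s : ℕ → ℝ := fun n => 1 / ((n : ℝ) + 1) with hs
  have hs0 : ∀ n, 0 < s n := fun n => by positivity
  have hs1 : ∀ n, s n ≤ 1 := fun n =>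
    (div_le_one (by positivity)).2 (by linarith [n.cast_nonneg (α := ℝ)])
  have hslim : Tendsto s atTop (𝓝 0) := tendsto_one_div_add_atTop_nhds_zero_nat
  -- Truncation multiplies `u * φ` by `a n` and, on `Ω`, `∇ φ` by `b n`. Both factors are bounded by
  -- 1 and tend to 1, so dominated convergence applies on both sides.
  set T : ℕ → EuclideanSpace ℝ (Fin N) → ℝ := fun n x => φ x / (1 + s n * φ x ^ 2) with hT
  set a : ℕ → EuclideanSpace ℝ (Fin N) → ℝ := fun n x => 1 / (1 + s n * φ x ^ 2) with ha
  set b : ℕ → EuclideanSpace ℝ (Fin N) → ℝ := fun n x =>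
    (1 - s n * φ x ^ 2) / (1 + s n * φ x ^ 2) ^ 2 with hbdef
  have ham : ∀ n, AEStronglyMeasurable (a n) μ := fun n => by
    have : AEMeasurable (a n) μ :=
      aemeasurable_const.div (((hφm.pow_const 2).const_mul (s n)).const_add 1)
    exact this.aestronglyMeasurable
  have hbm : ∀ n, AEStronglyMeasurable (b n) μ := fun n => by
    have : AEMeasurable (b n) μ :=
      (((hφm.pow_const 2).const_mul (s n)).const_sub 1).div
        ((((hφm.pow_const 2).const_mul (s n)).const_add 1).pow_const 2)
    exact this.aestronglyMeasurable
  have ha1 : ∀ n x, ‖a n x‖ ≤ 1 := fun n x => by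
    have h : 0 ≤ s n * φ x ^ 2 := mul_nonneg (hs0 n).le (sq_nonneg _)
    rw [Real.norm_of_nonneg (by positivity), div_le_one (by positivity)]
    linarith
  have hb1 : ∀ n x, ‖b n x‖ ≤ 1 := fun n x => abs_one_sub_div_le (hs0 n).le _
  have hsφ : ∀ x, Tendsto (fun n => s n * φ x ^ 2) atTop (𝓝 0) := fun x => by
    simpa using hslim.mul_const (φ x ^ 2)
  have halim : ∀ x, Tendsto (fun n => a n x) atTop (𝓝 1) := fun x => by
    have h := (tendsto_const_nhds (x := (1 : ℝ))).div ((hsφ x).const_add 1) (by norm_num)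
    have e : (1 : ℝ) / (1 + 0) = 1 := by norm_num
    rw [e] at h
    exact h
  have hblim : ∀ x, Tendsto (fun n => b n x) atTop (𝓝 1) := fun x => by
    have h := ((hsφ x).const_sub 1).div (((hsφ x).const_add 1).pow 2) (by norm_num)
    have e : (1 - 0 : ℝ) / (1 + 0) ^ 2 = 1 := by norm_num
    rw [e] at h
    exact h
  have hTu : ∀ n x, u x * T n x = a n x * (u x * φ x) := fun n x => by
    simp only [hT, ha]; ring
  have hTg : ∀ n, ∀ x ∈ Ω, inner ℝ (∇ (T n) x) (∇ ψ x) = b n x * inner ℝ (∇ φ x) (∇ ψ x) :=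
    fun n x hx => by
      have h := (hasDerivAt_div_one_add_mul_sq (hs0 n).le (φ x)).comp_hasFDerivAt x
        (hφ.differentiableAt (ho.mem_nhds hx)).hasFDerivAt
      rw [inner_gradient_left, inner_gradient_left]
      have h' : fderiv ℝ (T n) x = b n x • fderiv ℝ φ x := h.fderiv
      rw [h', smul_apply, smul_eq_mul]
  have hlim : ∀ (c : ℕ → EuclideanSpace ℝ (Fin N) → ℝ) (g : EuclideanSpace ℝ (Fin N) → ℝ),
      (∀ n, AEStronglyMeasurable (c n) μ) → (∀ n x, ‖c n x‖ ≤ 1) →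
      (∀ x, Tendsto (fun n => c n x) atTop (𝓝 1)) → Integrable g μ →
      Tendsto (fun n => ∫ x, c n x * g x ∂μ) atTop (𝓝 (∫ x, g x ∂μ)) :=
    fun c g hcm hc1 hcl hg => by
      refine tendsto_integral_of_dominated_convergence (fun x => ‖g x‖)
        (fun n => (hcm n).mul hg.aestronglyMeasurable) hg.norm
        (fun n => Eventually.of_forall fun x => ?_) (Eventually.of_forall fun x => ?_)
      · rw [norm_mul]
        exact mul_le_of_le_one_left (norm_nonneg _) (hc1 n x)
      · simpa using (hcl x).mul_const (g x)
  have heq : ∀ n, ∫ x, a n x * (u x * φ x) ∂μ = ∫ x, b n x * inner ℝ (∇ φ x) (∇ ψ x) ∂μ :=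
    fun n => by
      have hae : (fun x => inner ℝ (∇ (T n) x) (∇ ψ x)) =ᵐ[μ]
          fun x => b n x * inner ℝ (∇ φ x) (∇ ψ x) := by
        filter_upwards [hmem] with x hx using hTg n x hx
      have h := hψ.integral_mul_eq_of_bounded (φ := T n) ho hc hb hne hfd hfc hpos
        (fun x hx => ((hasDerivAt_div_one_add_mul_sq (hs0 n).le (φ x)).comp_hasFDerivAt x
          (hφ.differentiableAt (ho.mem_nhds hx)).hasFDerivAt).differentiableAt
            |>.differentiableWithinAt)
        (fun x _ => abs_div_one_add_mul_sq_le (hs0 n) (hs1 n) (φ x))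
        (by simpa only [hTu] using hu.bdd_mul (c := 1) (ham n) (Eventually.of_forall (ha1 n)))
        ((hi.bdd_mul (c := 1) (hbm n) (Eventually.of_forall (hb1 n))).congr hae.symm)
      rw [integral_congr_ae hae] at h
      simpa only [hTu] using h
  have h1 := hlim a _ ham ha1 halim hu
  simp only [heq] at h1
  exact tendsto_nhds_unique h1 (hlim b _ hbm hb1 hblim hi)

theorem hDotOneNorm_sq_eq (μ : Measure (EuclideanSpace ℝ (Fin N)))
    (φ : EuclideanSpace ℝ (Fin N) → ℝ) :
    hDotOneNorm μ φ ^ 2 = ∫⁻ x, ‖∇ φ x‖ₑ ^ 2 ∂μ := by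
  rw [hDotOneNorm, ← ENNReal.rpow_natCast, ← ENNReal.rpow_mul]
  norm_num

theorem lintegral_enorm_gradient_sq {μ : Measure (EuclideanSpace ℝ (Fin N))}
    (h : Integrable (fun x => ‖∇ φ x‖ ^ 2) μ) :
    ∫⁻ x, ‖∇ φ x‖ₑ ^ 2 ∂μ = ENNReal.ofReal (∫ x, ‖∇ φ x‖ ^ 2 ∂μ) := by
  rw [ofReal_integral_eq_lintegral_ofReal h (Eventually.of_forall fun x => sq_nonneg _)]
  refine lintegral_congr fun x => ?_
  rw [ENNReal.ofReal_pow (norm_nonneg _), ofReal_norm]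

theorem integrable_norm_gradient_sq {μ : Measure (EuclideanSpace ℝ (Fin N))}
    (h : hDotOneNorm μ φ ≠ ∞) : Integrable (fun x => ‖∇ φ x‖ ^ 2) μ := by
  refine ⟨((measurable_gradient φ).norm.pow_const 2).aestronglyMeasurable, ?_⟩
  have h1 : ∫⁻ x, ‖∇ φ x‖ₑ ^ 2 ∂μ < ∞ := by
    rw [← hDotOneNorm_sq_eq]; exact (ENNReal.pow_ne_top h).lt_top
  simpa [HasFiniteIntegral, enorm_pow] using h1

/-- The Cauchy-Schwarz inequality for the `Ḣ¹` inner product. -/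
theorem ofReal_integral_inner_le (μ : Measure (EuclideanSpace ℝ (Fin N)))
    (φ ψ : EuclideanSpace ℝ (Fin N) → ℝ) :
    ENNReal.ofReal (∫ x, inner ℝ (∇ φ x) (∇ ψ x) ∂μ) ≤ hDotOneNorm μ φ * hDotOneNorm μ ψ := by
  have h1 : ENNReal.ofReal (∫ x, inner ℝ (∇ φ x) (∇ ψ x) ∂μ) ≤
      ∫⁻ x, ‖∇ φ x‖ₑ * ‖∇ ψ x‖ₑ ∂μ := by
    refine (ENNReal.ofReal_le_ofReal (le_abs_self _)).trans ?_
    rw [← Real.norm_eq_abs, ofReal_norm]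
    refine (enorm_integral_le_lintegral_enorm _).trans (lintegral_mono fun x => ?_)
    rw [← ofReal_norm, ← ofReal_norm, ← ofReal_norm, ← ENNReal.ofReal_mul (norm_nonneg _)]
    exact ENNReal.ofReal_le_ofReal (norm_inner_le_norm _ _)
  have h2 := ENNReal.lintegral_mul_le_Lp_mul_Lq μ Real.HolderConjugate.two_two
    (measurable_gradient φ).enorm.aemeasurable (measurable_gradient ψ).enorm.aemeasurable
  refine h1.trans (h2.trans_eq ?_)
  simp only [hDotOneNorm, ENNReal.rpow_two]

end WeightedSobolev

end

/-! ### Duality: the supremum and its maximiser. -/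

theorem proposition3p2 {N : ℕ} (Ω : Set (EuclideanSpace ℝ (Fin N)))
    (hΩ_open : IsOpen Ω) (hΩ_convex : Convex ℝ Ω) (hΩ_bdd : Bornology.IsBounded Ω)
    (hΩ_ne : Ω.Nonempty)
    (f : EuclideanSpace ℝ (Fin N) → ℝ)
    (hf_diff : DifferentiableOn ℝ f Ω) (hf_cont : ContinuousOn f (closure Ω))
    (hf_pos : ∀ x ∈ Ω, 0 < f x)
    (μ : Measure (EuclideanSpace ℝ (Fin N))) (hμ : μ = WeightedSobolev.densityMeasure Ω f)
    (u : EuclideanSpace ℝ (Fin N) → ℝ) (hu_int : Integrable u μ) (hu_mean : ∫ x, u x ∂μ = 0)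
    (ψ : EuclideanSpace ℝ (Fin N) → ℝ) (hψ : WeightedSobolev.IsNeumannSolution Ω f u ψ) :
    (Integrable (fun x => ‖∇ ψ x‖ ^ 2) μ ∧
      Integrable (fun x => ψ x * WeightedSobolev.opL f ψ x) μ ∧
      Integrable (fun x => ψ x * u x) μ) ∧
    WeightedSobolev.hDotNegOneNorm Ω μ u ^ 2 = ENNReal.ofReal (∫ x, ‖∇ ψ x‖ ^ 2 ∂μ) ∧
    ∫ x, ‖∇ ψ x‖ ^ 2 ∂μ = ∫ x, ψ x * WeightedSobolev.opL f ψ x ∂μ ∧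
    ∫ x, ψ x * WeightedSobolev.opL f ψ x ∂μ = ∫ x, ψ x * u x ∂μ := by
  open WeightedSobolev in
  obtain ⟨B, hB0, hB⟩ := hψ.exists_norm_gradient_le hΩ_open hΩ_convex hΩ_bdd hΩ_ne
  obtain ⟨P, -, hP⟩ := exists_norm_le_of_continuousOn_closure hΩ_bdd
    hψ.contDiffOn_closure.continuousOn
  have hmem : ∀ᵐ x ∂μ, x ∈ Ω := hμ ▸ ae_densityMeasure_mem hΩ_open
  have hfin : IsFiniteMeasure μ := hμ ▸ isFiniteMeasure_densityMeasure hΩ_bdd hΩ_open hf_cont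
  have hψm : AEStronglyMeasurable ψ μ := by
    rw [hμ]
    exact (hψ.differentiableOn.continuousOn.aestronglyMeasurable hΩ_open.measurableSet).mono_ac
      densityMeasure_absolutelyContinuous
  have hgrad : Integrable (fun x => ‖∇ ψ x‖ ^ 2) μ := by
    refine Integrable.of_bound ((measurable_gradient ψ).norm.pow_const 2).aestronglyMeasurable
      (B ^ 2) ?_
    filter_upwards [hmem] with x hx
    rw [Real.norm_of_nonneg (by positivity)]
    exact pow_le_pow_left₀ (norm_nonneg _) (hB x hx) 2
  have hψu : Integrable (fun x => ψ x * u x) μ :=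
    hu_int.bdd_mul (c := P) hψm (hmem.mono hP)
  have hLu : (fun x => ψ x * opL f ψ x) =ᵐ[μ] fun x => ψ x * u x := by
    filter_upwards [hmem] with x hx
    rw [hψ.equation x hx]
  have hgreen : ∀ φ, DifferentiableOn ℝ φ Ω → Integrable (fun x => u x * φ x) μ →
      hDotOneNorm μ φ ≠ ∞ → ∫ x, u x * φ x ∂μ = ∫ x, inner ℝ (∇ φ x) (∇ ψ x) ∂μ := by
    intro φ hφ huφ hφn
    have hφi : Integrable (fun x => inner ℝ (∇ φ x) (∇ ψ x)) μ := by
      refine (((integrable_norm_gradient_sq hφn).add hgrad)).mono'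
        ((measurable_gradient φ).inner (measurable_gradient ψ)).aestronglyMeasurable
        (Eventually.of_forall fun x => ?_)
      refine (norm_inner_le_norm _ _).trans ?_
      simp only [Pi.add_apply]
      nlinarith [sq_nonneg (‖∇ φ x‖ - ‖∇ ψ x‖), sq_nonneg (‖∇ φ x‖ + ‖∇ ψ x‖)]
    subst hμ
    exact hψ.integral_mul_eq hΩ_open hΩ_convex hΩ_bdd hΩ_ne hf_diff hf_cont hf_pos hφ huφ hφi
  set J := ∫ x, ‖∇ ψ x‖ ^ 2 ∂μ with hJ
  have hJ0 : 0 ≤ J := integral_nonneg fun x => sq_nonneg _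
  have hnorm : hDotOneNorm μ ψ = ENNReal.ofReal (√J) := by
    rw [hDotOneNorm, lintegral_enorm_gradient_sq hgrad,
      ENNReal.ofReal_rpow_of_nonneg hJ0 (by norm_num), Real.sqrt_eq_rpow]
  have hψu' : Integrable (fun x => u x * ψ x) μ := by simpa only [mul_comm] using hψu
  have henergy : ∫ x, u x * ψ x ∂μ = J := by
    rw [hgreen ψ hψ.differentiableOn hψu' (by rw [hnorm]; exact ENNReal.ofReal_ne_top), hJ]
    simp only [real_inner_self_eq_norm_sq]
  have hJu : J = ∫ x, ψ x * u x ∂μ := by rw [← henergy]; simp only [mul_comm]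
  refine ⟨⟨hgrad, hψu.congr hLu.symm, hψu⟩, ?_, ?_, integral_congr_ae hLu⟩
  swap
  · rw [integral_congr_ae hLu, hJu]
  have hsup : hDotNegOneNorm Ω μ u = ENNReal.ofReal (√J) := by
    refine le_antisymm (sSup_le ?_) ?_
    · rintro r ⟨φ, hφ, huφ, hφ1, rfl⟩
      rw [hgreen φ hφ huφ (by rw [hφ1]; exact ENNReal.one_ne_top), ← hnorm]
      simpa [hφ1] using ofReal_integral_inner_le μ φ ψ
    -- If `J = 0`, then `ψ` cannot be normalised, but the lower bound is trivial. Otherwise `ψ`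
    -- divided by `√J` is the equality case of Cauchy-Schwarz.
    · rcases hJ0.eq_or_lt with h0 | h0
      · simp [← h0]
      have hs : 0 < √J := Real.sqrt_pos.2 h0
      refine le_sSup ⟨fun x => (√J)⁻¹ * ψ x, hψ.differentiableOn.const_mul _, ?_, ?_, ?_⟩
      · simpa only [mul_left_comm] using hψu'.const_mul (√J)⁻¹
      · have hg : ∀ᵐ x ∂μ, ‖∇ (fun x => (√J)⁻¹ * ψ x) x‖ₑ ^ 2 =
            ENNReal.ofReal ((√J)⁻¹ ^ 2) * ‖∇ ψ x‖ₑ ^ 2 := by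
          filter_upwards [hmem] with x hx
          have hd := hψ.differentiableOn.differentiableAt (hΩ_open.mem_nhds hx)
          have : ∇ (fun x => (√J)⁻¹ * ψ x) x = (√J)⁻¹ • ∇ ψ x := by
            rw [gradient, fderiv_const_mul hd, map_smulₛₗ]; rfl
          rw [this, enorm_smul, mul_pow, ENNReal.ofReal_pow (by positivity),
            Real.enorm_eq_ofReal (by positivity)]
        rw [hDotOneNorm, lintegral_congr_ae hg, lintegral_const_mul' _ _ ENNReal.ofReal_ne_top,
          lintegral_enorm_gradient_sq hgrad, ← ENNReal.ofReal_mul (by positivity), ← hJ, inv_pow,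
          Real.sq_sqrt hJ0, inv_mul_cancel₀ h0.ne']
        simp
      · have h : ∫ x, u x * ((√J)⁻¹ * ψ x) ∂μ = (√J)⁻¹ * J := by
          rw [← henergy, ← integral_const_mul]
          exact integral_congr_ae (Eventually.of_forall fun x => by ring)
        rw [h, inv_mul_eq_div, Real.div_sqrt]
  rw [hsup, ← ENNReal.ofReal_pow (Real.sqrt_nonneg _), Real.sq_sqrt hJ0]
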